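/- Let $\Omega$ be a finite set of states, $M$ a finite set of outcomes, $L=\Delta(M)$ the simplex of lotteries over $M$, and $O\notin M$. An event is a nonempty subset of $\Omega$. For a lottery $l\in L$ and an event $A$, the conditional constant act $(l,A,O,A^c)$ is the function $\Omega\to L\cup\{O\}$ equal to $l$ on $A$ and to $O$ on $A^c$. Let $\succcurlyeq$ be a (possibly incomplete) binary relation on the set of conditional constant acts; write $\sim$ for its symmetric part, write $x\succcurlyeq_A y$ for $(x,A,O,A^c)\succcurlyeq(y,A,O,A^c)$, write $\succ_A$ for the strict part of $\succcurlyeq_A$ (that is, $x\succcurlyeq_A y$ and not $y\succcurlyeq_A x$), and put $\succ_\omega=\succ_{\{\omega\}}$, $\succcurlyeq_\omega=\succcurlyeq_{\{\omega\}}$. Assume: 1. (Weak order) for every event $A$, $\succcurlyeq_A$ is complete and transitive; 2. (vN-M continuity) for every event $A$ and all $x,y,z\in L$ with $x\succ_A y\succ_A z$ there are $\alpha,\beta\in(0,1)$ with $\alpha x+(1-\alpha)z\succcurlyeq_A y\succcurlyeq_A\beta x+(1-\beta)z$; 3. (Independence) for every event $A$, all $x,y,z\in L$ and all $\alpha\in(0,1)$: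 $x\succcurlyeq_A y$ if and only if $\alpha x+(1-\alpha)z\succcurlyeq_A\alpha y+(1-\alpha)z$; 4. (Extended Pareto) for all disjoint events $A,B$ and all $x,y\in L$: $x\succcurlyeq_A y$ and $x\succcurlyeq_B y$ imply $x\succcurlyeq_{A\cup B}y$; and $x\succ_A y$ and $x\succcurlyeq_B y$ imply $x\succ_{A\cup B}y$; 5. (Richness) there are three distinct states such that for each $\omega$ among them there are $x,y\in L$ with $x\succ_\omega y$ and $y\succcurlyeq_{\omega'}x$ for the two others $\omega'$; 6. (Strong minimal agreement) $\overline x,\underline x\in L$ are lotteries such that $\overline x\succ_\omega\underline x$ for every $\omega\in\Omega$, and for all $\omega_1,\omega_2\in\Omega$ and each $l\in\{\overline x,\underline x\}$, $(l,\{\omega_1\},O,\Omega\setminus\{\omega_1\})\sim(l,\{\omega_2\},O,\Omega\setminus\{\omega_2\})$. Say that $(P,u)$ is a representation of $\succcurlyeq$ if $u:\Omega\times M\to\mathbb R$ is a function, $P:\Omega\to\mathbb R_{++}$ is a probability measure, and for every event $A$ and all $x,y\in L$ $$x\succcurlyeq_A y\iff\sum_{\omega\in A}P(\omega|A)\,E^x[u(\omega,\cdot)]\ge\sum_{\omega\in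 A}P(\omega|A)\,E^y[u(\omega,\cdot)],$$ where $P(\omega|A)=P(\omega)/\sum_{\omega'\in A}P(\omega')$ and $E^x[u(\omega,\cdot)]=\sum_{m\in M}x_m u(\omega,m)$. Say that $u$ respects the state-indifference of $l\in L$ if $E^l[u(\omega_1,\cdot)]=E^l[u(\omega_2,\cdot)]$ for all $\omega_1,\omega_2\in\Omega$ with $(l,\{\omega_1\},O,\Omega\setminus\{\omega_1\})\sim(l,\{\omega_2\},O,\Omega\setminus\{\omega_2\})$. Then there is a representation $(P,u)$ such that $u$ respects the state-indifference of $\overline x$ and of $\underline x$. Moreover, among such representations $P$ is unique and $u$ is unique up to a common positive affine transformation: a pair $(Q,w)$ is a representation such that $w$ respects the state-indifference of $\overline x$ and of $\underline x$ if and only if $Q=P$ and there are $a>0$ and $b\in\mathbb R$ with $w(\omega,m)=a\,u(\omega,m)+b$ for all $\omega\in\Omega$, $m\in M$. -/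

import Mathlib

namespace StateDep

/-- Events that can be conditioned on: the nonempty subsets of the set of states. -/
abbrev Event (Ω : Type*) : Type _ := {A : Finset Ω // A.Nonempty}

/-- The simplex of lotteries over the finite set of outcomes `M`. -/
abbrev Lottery (M : Type*) [Fintype M] : Type _ := stdSimplex ℝ M

/-- The event consisting of one state. -/
def Event.single {Ω : Type*} (ω : Ω) : Event Ω := ⟨{ω}, Finset.singleton_nonempty ω⟩

/-- The union of two events. -/
def Event.union {Ω : Type*} [DecidableEq Ω] (A B : Event Ω) : Event Ω :=
  ⟨A.1 ∪ B.1, A.2.mono Finset.subset_union_left⟩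

/-- The mixture `α x + (1 - α) y` of two lotteries, for `α` in the open unit interval. -/
def mix {M : Type*} [Fintype M] (α : Set.Ioo (0 : ℝ) 1) (x y : Lottery M) : Lottery M :=
  ⟨(α : ℝ) • (x : M → ℝ) + (1 - (α : ℝ)) • (y : M → ℝ),
    convex_stdSimplex ℝ M x.2 y.2 α.2.1.le (sub_nonneg.2 α.2.2.le) (add_sub_cancel _ _)⟩

/-- The function `Ω → L ∪ {O}` equal to the lottery `l` on `A` and to `O` (here `none`)
off `A`. -/
def actFun {Ω M : Type*} [DecidableEq Ω] [Fintype M] (l : Lottery M) (A : Event Ω) :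
    Ω → Option (Lottery M) :=
  fun ω => if ω ∈ A.1 then some l else none

/-- The conditional constant acts: the functions `(l, A, O, Aᶜ)` with `l` a lottery and `A` a
nonempty event. -/
def CondAct (Ω M : Type*) [DecidableEq Ω] [Fintype M] : Type _ :=
  {f : Ω → Option (Lottery M) // ∃ (l : Lottery M) (A : Event Ω), f = actFun l A}

/-- The conditional constant act `(l, A, O, Aᶜ)`. -/
def act {Ω M : Type*} [DecidableEq Ω] [Fintype M] (l : Lottery M) (A : Event Ω) :
    CondAct Ω M :=
  ⟨actFun l A, l, A, rfl⟩

section Preferences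

variable {Ω M : Type*} [DecidableEq Ω] [Fintype M]

/-- Indifference between two conditional constant acts. -/
def Indiff (R : CondAct Ω M → CondAct Ω M → Prop) (f g : CondAct Ω M) : Prop :=
  R f g ∧ R g f

/-- The conditional weak preference given `A`. -/
def WeakPref (R : CondAct Ω M → CondAct Ω M → Prop) (A : Event Ω) (x y : Lottery M) : Prop :=
  R (act x A) (act y A)

/-- The conditional strict preference given `A`. -/
def StrictPref (R : CondAct Ω M → CondAct Ω M → Prop) (A : Event Ω) (x y : Lottery M) : Prop :=
  WeakPref R A x y ∧ ¬ WeakPref R A y x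

/-- Every conditional preference is complete and transitive. -/
def WeakOrder (R : CondAct Ω M → CondAct Ω M → Prop) : Prop :=
  ∀ A : Event Ω,
    (∀ x y : Lottery M, WeakPref R A x y ∨ WeakPref R A y x) ∧
    (∀ x y z : Lottery M, WeakPref R A x y → WeakPref R A y z → WeakPref R A x z)

/-- von Neumann-Morgenstern (Archimedean) continuity of every conditional preference. -/
def VNMContinuity (R : CondAct Ω M → CondAct Ω M → Prop) : Prop :=
  ∀ (A : Event Ω) (x y z : Lottery M), StrictPref R A x y → StrictPref R A y z →
    ∃ α β : Set.Ioo (0 : ℝ) 1, WeakPref R A (mix α x z) y ∧ WeakPref R A y (mix β x z)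

/-- von Neumann-Morgenstern independence of every conditional preference. -/
def Independence (R : CondAct Ω M → CondAct Ω M → Prop) : Prop :=
  ∀ (A : Event Ω) (x y z : Lottery M) (α : Set.Ioo (0 : ℝ) 1),
    WeakPref R A x y ↔ WeakPref R A (mix α x z) (mix α y z)

/-- The extended Pareto property, with its weak and its strict part. -/
def ExtendedPareto (R : CondAct Ω M → CondAct Ω M → Prop) : Prop :=
  ∀ A B : Event Ω, Disjoint A.1 B.1 → ∀ x y : Lottery M,
    (WeakPref R A x y → WeakPref R B x y → WeakPref R (A.union B) x y) ∧
    (StrictPref R A x y → WeakPref R B x y → StrictPref R (A.union B) x y)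

/-- Richness: there are three distinct states such that for each of them some pair of lotteries
is strictly ranked in that state and weakly ranked the other way in the two others. -/
def Richness (R : CondAct Ω M → CondAct Ω M → Prop) : Prop :=
  ∃ T : Finset Ω, T.card = 3 ∧ ∀ ω ∈ T, ∃ x y : Lottery M,
    StrictPref R (Event.single ω) x y ∧
    ∀ ω' ∈ T, ω' ≠ ω → WeakPref R (Event.single ω') y x

/-- The lottery `l` is indifferent to the realization of the state. -/
def StateIndifferent (R : CondAct Ω M → CondAct Ω M → Prop) (l : Lottery M) : Prop :=
  ∀ ω₁ ω₂ : Ω, Indiff R (act l (Event.single ω₁)) (act l (Event.single ω₂))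

/-- The lotteries `xhi`, `xlo` witness strong minimal agreement. -/
def StrongMinimalAgreement (R : CondAct Ω M → CondAct Ω M → Prop) (xhi xlo : Lottery M) : Prop :=
  (∀ ω : Ω, StrictPref R (Event.single ω) xhi xlo) ∧
  StateIndifferent R xhi ∧ StateIndifferent R xlo

/-- The expected utility of the lottery `x` in the state `ω`. -/
def expUtil (u : Ω → M → ℝ) (ω : Ω) (x : Lottery M) : ℝ :=
  ∑ m, (x : M → ℝ) m * u ω m

/-- A probability measure on the finite set of states with strictly positive weights. -/
def IsPosProb [Fintype Ω] (P : Ω → ℝ) : Prop :=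
  (∀ ω, 0 < P ω) ∧ ∑ ω, P ω = 1

/-- The conditional probability `P(ω | A)`, by Bayes' rule. -/
noncomputable def condProb (P : Ω → ℝ) (A : Event Ω) (ω : Ω) : ℝ :=
  (if ω ∈ A.1 then P ω else 0) / ∑ ω' ∈ A.1, P ω'

/-- The conditional expected utility of the lottery `x` given the event `A`. -/
noncomputable def condExpUtil (P : Ω → ℝ) (u : Ω → M → ℝ) (A : Event Ω) (x : Lottery M) : ℝ :=
  ∑ ω ∈ A.1, condProb P A ω * expUtil u ω x

/-- `(P, u)` is a state-dependent conditional expected utility representation. -/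
def Represents [Fintype Ω] (R : CondAct Ω M → CondAct Ω M → Prop)
    (P : Ω → ℝ) (u : Ω → M → ℝ) : Prop :=
  IsPosProb P ∧ ∀ (A : Event Ω) (x y : Lottery M),
    WeakPref R A x y ↔ condExpUtil P u A x ≥ condExpUtil P u A y

/-- The state-dependent utility `u` respects the indifferences between the acts that yield the
lottery `l` in exactly one state. -/
def RespectsIndiff (R : CondAct Ω M → CondAct Ω M → Prop) (u : Ω → M → ℝ) (l : Lottery M) : Prop :=
  ∀ ω₁ ω₂ : Ω, Indiff R (act l (Event.single ω₁)) (act l (Event.single ω₂)) →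
    expUtil u ω₁ l = expUtil u ω₂ l

end Preferences

end StateDep

/-! By extended Pareto, `xhi` is strictly preferred to `xlo` given every event, so the von
Neumann-Morgenstern theorem (`IsVNM.exists_utility`) gives each conditional preference a unique
utility `V A` with value 1 at `xhi` and 0 at `xlo`. With this normalization Pareto becomes Harsanyi
aggregation: `V (A ∪ B)` is a strictly positive combination of `V A` and `V B` for disjoint `A`, `B`
(`exists_pos_combination_of_pareto`). Richness makes the utilities of three states linearly
independent (`indepTriple_of_separated`).

What remains is linear algebra: a family of height-one vectors with this betweenness property, not
contained in a plane, consists of averages of its singleton vectors for a single positive weight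
(`IsBetweenFamily.exists_weights`). Two-element events yield odds; independence makes the odds
multiplicative, so they are ratios of weights; induction on cardinality extends the averaging
formula to all events. The normalized weight is `P`, and `u ω` is the utility given `{ω}`.

For uniqueness, respecting the two state-indifferences makes the utilities of `xhi` and `xlo`
constant across states, so one affine map normalizes any competing utility. The utilities given
events are then the same vectors `V A`, and these determine the probability. -/

namespace StateDep

/-! ### Betweenness families and the weights that generate them. -/

section Weights

variable {Ω E : Type*} [DecidableEq Ω] [AddCommGroup E] [Module ℝ E]

/-- A family of vectors of `φ`-height one, indexed by the nonempty sets of states, in which the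
vector of a disjoint union lies strictly between the vectors of its two parts. -/
structure IsBetweenFamily (φ : E →ₗ[ℝ] ℝ) (U : Finset Ω → E) : Prop where
  height : ∀ A : Finset Ω, A.Nonempty → φ (U A) = 1
  union : ∀ A B : Finset Ω, A.Nonempty → B.Nonempty → Disjoint A B →
    ∃ a b : ℝ, 0 < a ∧ 0 < b ∧ U (A ∪ B) = a • U A + b • U B

/-- Linear independence of three vectors, in terms of coefficients. -/
def IndepTriple (x y z : E) : Prop :=
  ∀ a b c : ℝ, a • x + b • y + c • z = 0 → a = 0 ∧ b = 0 ∧ c = 0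

/-- The odds `r a b` place `U {a, b}` on the segment between `U {a}` and `U {b}`. -/
def IsOdds (U : Finset Ω → E) (r : Ω → Ω → ℝ) : Prop :=
  ∀ a b, U {a} ≠ U {b} → 0 < r a b ∧ (r a b + 1) • U {a, b} = r a b • U {a} + U {b}

variable {φ : E →ₗ[ℝ] ℝ} {U : Finset Ω → E} {r : Ω → Ω → ℝ}

lemma indepTriple_of_notMem_span {x y z : E} (hx : φ x = 1) (hy : φ y = 1) (hxy : x ≠ y)
    (hz : z ∉ Submodule.span ℝ {x, y}) : IndepTriple x y z := by
  intro a b c h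
  have hc : c = 0 := by
    by_contra hc
    refine hz (Submodule.mem_span_pair.2 ⟨-(c⁻¹ * a), -(c⁻¹ * b), ?_⟩)
    have h2 : c⁻¹ • (a • x + b • y + c • z) = 0 := by rw [h, smul_zero]
    have h3 : c⁻¹ • (a • x + b • y + c • z) = (c⁻¹ * a) • x + (c⁻¹ * b) • y + (c⁻¹ * c) • z := by
      module
    rw [inv_mul_cancel₀ hc, h2] at h3
    have h4 : z = (0 : E) - ((c⁻¹ * a) • x + (c⁻¹ * b) • y) := by rw [h3]; module
    rw [h4]; module
  subst hc
  have h1 : a + b = 0 := by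
    have := congrArg φ h
    simpa [hx, hy] using this
  obtain rfl : b = -a := by linarith
  have h2 : a • (x - y) = 0 := by rw [← h]; module
  rcases smul_eq_zero.1 h2 with h3 | h3
  · exact ⟨h3, by simp [h3], rfl⟩
  · exact absurd (sub_eq_zero.1 h3) hxy

lemma IsBetweenFamily.exists_odds (hU : IsBetweenFamily φ U) : ∃ r, IsOdds U r := by
  have : ∀ a b : Ω, ∃ r : ℝ, U {a} ≠ U {b} →
      0 < r ∧ (r + 1) • U {a, b} = r • U {a} + U {b} := by
    intro a b
    by_cases hab : U {a} = U {b}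
    · exact ⟨0, fun h => absurd hab h⟩
    have hne : a ≠ b := fun h => hab (by rw [h])
    obtain ⟨s, t, hs, ht, h⟩ := hU.union {a} {b} (Finset.singleton_nonempty a)
      (Finset.singleton_nonempty b) (by simpa using hne)
    have hst : s + t = 1 := by
      have := congrArg φ h
      rw [hU.height _ ⟨a, by simp⟩] at this
      simpa [hU.height] using this.symm
    refine ⟨s / t, fun _ => ⟨by positivity, ?_⟩⟩
    have e : ({a, b} : Finset Ω) = {a} ∪ {b} := rfl
    have e1 : s / t + 1 = 1 / t := by rw [div_add_one ht.ne', hst]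
    rw [e, h, e1, smul_add, smul_smul, smul_smul, one_div_mul_cancel ht.ne', one_smul]
    congr 2; ring
  choose r hr using this
  exact ⟨r, hr⟩

/-- The vector of `{a, b, c}` can be split along each of its three pairs. Its coordinates in the
independent triple are unique, and their ratios are the three odds. -/
lemma IsOdds.mul_of_indepTriple (hU : IsBetweenFamily φ U) (hr : IsOdds U r) {a b c : Ω}
    (h : IndepTriple (U {a}) (U {b}) (U {c})) : r a b * r b c = r a c := by
  have hab : U {a} ≠ U {b} := fun e => by simpa using (h 1 (-1) 0 (by rw [e]; module)).1
  have hbc : U {b} ≠ U {c} := fun e => by simpa using (h 0 1 (-1) (by rw [e]; module)).2.1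
  have hac : U {a} ≠ U {c} := fun e => by simpa using (h 1 0 (-1) (by rw [e]; module)).1
  have nab : a ≠ b := fun h => hab (by rw [h])
  have nbc : b ≠ c := fun h => hbc (by rw [h])
  have nac : a ≠ c := fun h => hac (by rw [h])
  obtain ⟨p1, e1⟩ := hr a b hab
  obtain ⟨p2, e2⟩ := hr b c hbc
  obtain ⟨p3, e3⟩ := hr a c hac
  obtain ⟨x1, y1, hx1, hy1, f1⟩ := hU.union {a, b} {c} ⟨a, by simp⟩ ⟨c, by simp⟩
    (by simp [nac.symm, nbc.symm])
  obtain ⟨x2, y2, hx2, hy2, f2⟩ := hU.union {b, c} {a} ⟨b, by simp⟩ ⟨a, by simp⟩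
    (by simp [nac, nab])
  obtain ⟨x3, y3, hx3, hy3, f3⟩ := hU.union {a, c} {b} ⟨a, by simp⟩ ⟨b, by simp⟩
    (by simp [nab.symm, nbc])
  have g2 : ({b, c} ∪ {a} : Finset Ω) = {a, b} ∪ {c} := by ext; simp; tauto
  have g3 : ({a, c} ∪ {b} : Finset Ω) = {a, b} ∪ {c} := by ext; simp; tauto
  rw [g2] at f2
  rw [g3] at f3
  have solve : ∀ {s : ℝ} {v w : E}, 0 < s → s • v = w → v = s⁻¹ • w := by
    intro s v w hs e
    rw [← e, smul_smul, inv_mul_cancel₀ hs.ne', one_smul]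
  rw [solve (by linarith) e1] at f1
  rw [solve (by linarith) e2, f1] at f2
  rw [solve (by linarith) e3, f1] at f3
  have q1 : 0 < (r a b + 1)⁻¹ := by positivity
  have q2 : 0 < (r b c + 1)⁻¹ := by positivity
  have q3 : 0 < (r a c + 1)⁻¹ := by positivity
  generalize (r a b + 1)⁻¹ = i1 at *
  generalize (r b c + 1)⁻¹ = i2 at *
  generalize (r a c + 1)⁻¹ = i3 at *
  obtain ⟨A1, A2, A3⟩ := h (x1 * i1 * r a b - y2) (x1 * i1 - x2 * i2 * r b c) (y1 - x2 * i2) (by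
    rw [← sub_eq_zero] at f2; rw [← f2]; module)
  obtain ⟨B1, B2, B3⟩ := h (x1 * i1 * r a b - x3 * i3 * r a c) (x1 * i1 - y3) (y1 - x3 * i3) (by
    rw [← sub_eq_zero] at f3; rw [← f3]; module)
  -- The coordinates at `a`, `b`, `c` are `x1 * i1 * r a b`, `x1 * i1` and `y1`.
  have k1 : x1 * i1 = y1 * r b c := by linear_combination A2 - r b c * A3
  have k2 : x1 * i1 * r a b = y1 * r a c := by linear_combination B1 - r a c * B3
  have : y1 * (r a b * r b c - r a c) = 0 := by linear_combination k2 - r a b * k1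
  rcases mul_eq_zero.1 this with h | h
  · exact absurd h hy1.ne'
  · linarith

/-- Dependent triples reduce to independent ones: with `d` off the plane of `U {a}` and `U {b}`,
each of the three odds is a quotient of odds against `d`. -/
lemma IsOdds.mul (hU : IsBetweenFamily φ U) (hr : IsOdds U r)
    (hT : ∀ x y : E, ∃ d, U {d} ∉ Submodule.span ℝ {x, y}) {a b c : Ω}
    (hab : U {a} ≠ U {b}) (hbc : U {b} ≠ U {c}) (hac : U {a} ≠ U {c}) :
    r a b * r b c = r a c := by
  have h1 : ∀ i : Ω, φ (U {i}) = 1 := fun i => hU.height _ (Finset.singleton_nonempty i)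
  by_cases hc : U {c} ∈ Submodule.span ℝ {U {a}, U {b}}
  · obtain ⟨d, hd⟩ := hT (U {a}) (U {b})
    have ma : U {a} ∈ Submodule.span ℝ {U {a}, U {b}} := Submodule.subset_span (by simp)
    have mb : U {b} ∈ Submodule.span ℝ {U {a}, U {b}} := Submodule.subset_span (by simp)
    have key : ∀ {i j : Ω}, U {i} ∈ Submodule.span ℝ {U {a}, U {b}} →
        U {j} ∈ Submodule.span ℝ {U {a}, U {b}} → U {i} ≠ U {j} → r i j * r j d = r i d := by
      intro i j hi hj hij
      refine hr.mul_of_indepTriple hU (indepTriple_of_notMem_span (h1 i) (h1 j) hij fun h => hd ?_)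
      refine Submodule.span_le.2 ?_ h
      rintro _ (rfl | rfl)
      exacts [hi, hj]
    have k1 := key ma mb hab
    have k2 := key mb hc hbc
    have k3 := key ma hc hac
    have pos : 0 < r c d := (hr c d fun e => hd (e ▸ hc)).1
    have : r c d * (r a b * r b c - r a c) = 0 := by
      linear_combination r a b * k2 + k1 - k3
    rcases mul_eq_zero.1 this with h | h
    · exact absurd h pos.ne'
    · linarith
  · exact hr.mul_of_indepTriple hU (indepTriple_of_notMem_span (h1 a) (h1 b) hab hc)

lemma ne_of_notMem_span_pair {x y z : E} (h : z ∉ Submodule.span ℝ {x, y}) : x ≠ z ∧ y ≠ z :=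
  ⟨fun e => h (e ▸ Submodule.subset_span (by simp)),
    fun e => h (e ▸ Submodule.subset_span (by simp))⟩

/-- The odds of pairs of states come from one positive weight on the states. -/
lemma IsBetweenFamily.exists_pair_weights (hU : IsBetweenFamily φ U)
    (hT : ∀ x y : E, ∃ d, U {d} ∉ Submodule.span ℝ {x, y}) :
    ∃ p : Ω → ℝ, (∀ i, 0 < p i) ∧
      ∀ a b, a ≠ b → (p a + p b) • U {a, b} = p a • U {a} + p b • U {b} := by
  obtain ⟨r, hr⟩ := hU.exists_odds
  obtain ⟨o, -⟩ := hT 0 0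
  have av : ∀ a b : Ω, ∃ d, U {a} ≠ U {d} ∧ U {b} ≠ U {d} := fun a b => by
    obtain ⟨d, hd⟩ := hT (U {a}) (U {b})
    exact ⟨d, ne_of_notMem_span_pair hd⟩
  have M : ∀ {a b c : Ω}, U {a} ≠ U {b} → U {b} ≠ U {c} → U {a} ≠ U {c} →
      r a b * r b c = r a c := fun h1 h2 h3 => hr.mul hU hT h1 h2 h3
  have aux : ∀ {a d e : Ω}, U {a} ≠ U {d} → U {o} ≠ U {d} → U {a} ≠ U {e} → U {o} ≠ U {e} →
      U {d} ≠ U {e} → r a d * r d o = r a e * r e o := by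
    intro a d e h1 h2 h3 h4 h5
    rw [← M h3 h5.symm h1, mul_assoc, M h5.symm h2.symm h4.symm]
  have indep : ∀ {a d e : Ω}, U {a} ≠ U {d} → U {o} ≠ U {d} → U {a} ≠ U {e} → U {o} ≠ U {e} →
      r a d * r d o = r a e * r e o := by
    intro a d e h1 h2 h3 h4
    by_cases hao : U {a} = U {o}
    · by_cases hde : U {d} = U {e}
      · obtain ⟨g, g1, g2⟩ := av a d
        rw [aux h1 h2 g1 (hao ▸ g1) g2, aux h3 h4 g1 (hao ▸ g1) (hde ▸ g2)]
      · exact aux h1 h2 h3 h4 hde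
    · rw [M h1 h2.symm hao, M h3 h4.symm hao]
  -- The weight of `i` should be `r i o`, but those odds carry no information when `U {i} = U {o}`.
  -- Passing through an intermediate state `f i` avoids this, and `indep` shows that the choice is
  -- immaterial.
  choose f hf1 hf2 using fun a => av a o
  have ppos : ∀ i, 0 < r i (f i) * r (f i) o := fun i =>
    mul_pos (hr _ _ (hf1 i)).1 (hr _ _ (hf2 i).symm).1
  refine ⟨fun i => r i (f i) * r (f i) o, ppos, fun a b nab => ?_⟩
  by_cases hab : U {a} = U {b}
  · obtain ⟨s, t, -, -, h⟩ := hU.union {a} {b} (Finset.singleton_nonempty a)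
      (Finset.singleton_nonempty b) (by simpa using nab)
    have hst : s + t = 1 := by
      have := congrArg φ h
      rw [hU.height _ ⟨a, by simp⟩] at this
      simpa [hU.height] using this.symm
    have e : ({a, b} : Finset Ω) = {a} ∪ {b} := rfl
    rw [e, h, ← hab, ← add_smul, hst, one_smul, add_smul]
  have key : r a (f a) * r (f a) o = r a b * (r b (f b) * r (f b) o) := by
    by_cases hd : ∃ d, U {a} ≠ U {d} ∧ U {b} ≠ U {d} ∧ U {o} ≠ U {d}
    · obtain ⟨d, h1, h2, h3⟩ := hd
      rw [indep (hf1 a) (hf2 a) h1 h3, indep (hf1 b) (hf2 b) h2 h3, ← M hab h2 h1, mul_assoc]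
    -- If no vector differs from all three, `U {a}` and `U {b}` both differ from `U {o}`, so the
    -- direct odds against `o` are available.
    · have hao : U {a} ≠ U {o} := fun h => by
        obtain ⟨d, h1, h2⟩ := av a b
        exact hd ⟨d, h1, h2, h ▸ h1⟩
      have hbo : U {b} ≠ U {o} := fun h => by
        obtain ⟨d, h1, h2⟩ := av a b
        exact hd ⟨d, h1, h2, h ▸ h2⟩
      rw [M (hf1 a) (hf2 a).symm hao, M (hf1 b) (hf2 b).symm hbo, M hab hbo hao]
  have hb := ppos b
  obtain ⟨-, e⟩ := hr a b hab
  simp only [key]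
  generalize r b (f b) * r (f b) o = q at *
  have : q • ((r a b + 1) • U {a, b}) = q • (r a b • U {a} + U {b}) := by rw [e]
  linear_combination (norm := module) this

/-- The weights of pairs of states determine the whole family. -/
lemma IsBetweenFamily.eq_smul_sum (hU : IsBetweenFamily φ U)
    (hT : ∀ x y : E, ∃ d, U {d} ∉ Submodule.span ℝ {x, y}) {p : Ω → ℝ} (hp : ∀ i, 0 < p i)
    (hpair : ∀ a b, a ≠ b → (p a + p b) • U {a, b} = p a • U {a} + p b • U {b}) :
    ∀ (n : ℕ) (A : Finset Ω), A.card = n → A.Nonempty → ∃ c : ℝ, U A = c • ∑ i ∈ A, p i • U {i} := by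
  have h1 : ∀ i : Ω, φ (U {i}) = 1 := fun i => hU.height _ (Finset.singleton_nonempty i)
  intro n
  induction n using Nat.strong_induction_on with
  | _ n ih =>
  intro A hA hne
  set V : Finset Ω → E := fun B => ∑ i ∈ B, p i • U {i} with hV
  have Vunion : ∀ {B C : Finset Ω}, Disjoint B C → V (B ∪ C) = V B + V C := fun h =>
    Finset.sum_union h
  have Vsingle : ∀ i, V {i} = p i • U {i} := fun i => Finset.sum_singleton _ _
  have split : ∀ {B C : Finset Ω}, B.Nonempty → C.Nonempty → Disjoint B C → B.card < n →
      C.card < n → ∃ a b : ℝ, U (B ∪ C) = a • V B + b • V C := by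
    intro B C hB hC hBC hBn hCn
    obtain ⟨a, b, -, -, h⟩ := hU.union B C hB hC hBC
    obtain ⟨c, hc⟩ := ih _ hBn B rfl hB
    obtain ⟨d, hd⟩ := ih _ hCn C rfl hC
    exact ⟨a * c, b * d, by rw [h, hc, hd, smul_smul, smul_smul]⟩
  have VA : φ (V A) ≠ 0 := by
    have : φ (V A) = ∑ i ∈ A, p i := by simp [hV, h1]
    rw [this]
    exact (Finset.sum_pos (fun i _ => hp i) hne).ne'
  rcases lt_trichotomy n 2 with hn | hn | hn
  · obtain ⟨a, rfl⟩ := Finset.card_eq_one.1 (show A.card = 1 by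
      have := hne.card_pos; omega)
    refine ⟨(p a)⁻¹, ?_⟩
    rw [show (∑ i ∈ {a}, p i • U {i}) = p a • U {a} from Vsingle a, smul_smul,
      inv_mul_cancel₀ (hp a).ne', one_smul]
  · obtain ⟨a, b, hab, rfl⟩ := Finset.card_eq_two.1 (hA.trans hn)
    refine ⟨(p a + p b)⁻¹, ?_⟩
    have : p a + p b ≠ 0 := (add_pos (hp a) (hp b)).ne'
    rw [Finset.sum_pair hab, ← hpair a b hab, smul_smul, inv_mul_cancel₀ this, one_smul]
  -- From here `A` has at least three states, and `U A` is assumed not to be a multiple of `V A`.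
  -- Removing one state at a time puts every `U {i}`, `i ∈ A`, in the plane `W` of `V A` and `U A`.
  by_contra hcon
  have hspan : U A ∉ Submodule.span ℝ {V A} := fun h => by
    obtain ⟨c, hc⟩ := Submodule.mem_span_singleton.1 h
    exact hcon ⟨c, hc.symm⟩
  have step : ∀ i ∈ A, ∃ a b : ℝ, U A = a • V A + b • U {i} := by
    intro i hi
    have hcard : (A.erase i).card = n - 1 := by rw [Finset.card_erase_of_mem hi, hA]
    have hd : Disjoint (A.erase i) {i} := by simp
    have hu : A.erase i ∪ {i} = A := by
      rw [Finset.union_comm, ← Finset.insert_eq, Finset.insert_erase hi]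
    obtain ⟨a, b, h⟩ := split (B := A.erase i) (C := {i})
      (Finset.card_pos.1 (by omega)) (Finset.singleton_nonempty i) hd (by omega) (by simp; omega)
    have hs := Vunion hd
    rw [hu] at h hs
    refine ⟨a, (b - a) * p i, ?_⟩
    rw [h, hs, Vsingle]; module
  set W := Submodule.span ℝ {V A, U A} with hW
  have WV : V A ∈ W := Submodule.subset_span (by simp)
  have WU : U A ∈ W := Submodule.subset_span (by simp)
  have Wi : ∀ i ∈ A, U {i} ∈ W := by
    intro i hi
    obtain ⟨a, b, h⟩ := step i hi
    have hb : b ≠ 0 := by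
      rintro rfl
      exact hcon ⟨a, by rw [h, zero_smul, add_zero]⟩
    have e : U {i} = b⁻¹ • (U A - a • V A) := by
      rw [h, add_sub_cancel_left, smul_smul, inv_mul_cancel₀ hb, one_smul]
    rw [e]
    exact W.smul_mem _ (W.sub_mem WU (W.smul_mem _ WV))
  obtain ⟨d, hd⟩ := hT (V A) (U A)
  have hdA : d ∉ A := fun h => hd (Wi d h)
  obtain ⟨e, f, he, -, hS⟩ := hU.union A {d} hne (Finset.singleton_nonempty d) (by simpa using hdA)
  -- Splitting `A ∪ {d}` as `C ∪ (A \ C ∪ {d})` for a pair `C` and comparing coefficients of `U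
  -- {d}`, which lies off `W`, gives `z = (a - b) • V C`. Since `z` does not depend on `C`, all the
  -- `V C` are parallel to it.
  set z := e • U A - (f / p d) • V A with hz
  have pairs : ∀ C ⊆ A, C.card = 2 → V C ∈ Submodule.span ℝ {z} := by
    intro C hCA hC
    have hcard : (A \ C).card = n - 2 := by rw [Finset.card_sdiff_of_subset hCA, hA, hC]
    have hdis : Disjoint (A \ C) {d} := by simp [hdA]
    have hdis2 : Disjoint C (A \ C ∪ {d}) := by
      rw [Finset.disjoint_union_right]
      exact ⟨Finset.disjoint_sdiff, by simpa using fun h => hdA (hCA h)⟩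
    have hu : C ∪ (A \ C ∪ {d}) = A ∪ {d} := by
      rw [← Finset.union_assoc, Finset.union_sdiff_of_subset hCA]
    obtain ⟨a, b, h⟩ := split (B := C) (C := A \ C ∪ {d}) (Finset.card_pos.1 (by omega))
      ⟨d, by simp⟩ hdis2 (by omega)
      (by rw [Finset.card_union_of_disjoint hdis, hcard, Finset.card_singleton]; omega)
    have hVA : V A = V C + V (A \ C) := by
      rw [← Vunion Finset.disjoint_sdiff, Finset.union_sdiff_of_subset hCA]
    have hVC : V (A \ C) = V A - V C := by rw [hVA]; abel
    rw [hu, hS, Vunion hdis, Vsingle, hVC] at h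
    have WC : V C ∈ W := W.sum_mem fun i hi => W.smul_mem _ (Wi i (hCA hi))
    have hfb : f - b * p d = 0 := by
      by_contra hne
      refine hd ?_
      have e1 : (f - b * p d) • U {d} = (a - b) • V C + b • V A - e • U A := by
        linear_combination (norm := module) h
      have e2 : U {d} = (f - b * p d)⁻¹ • ((a - b) • V C + b • V A - e • U A) := by
        rw [← e1, smul_smul, inv_mul_cancel₀ hne, one_smul]
      rw [e2]
      exact W.smul_mem _ (W.sub_mem (W.add_mem (W.smul_mem _ WC) (W.smul_mem _ WV))
        (W.smul_mem _ WU))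
    have hb : f / p d = b := by
      rw [div_eq_iff (hp d).ne']; linarith
    have hzC : z = (a - b) • V C := by
      have hf : f = b * p d := by linarith
      rw [hz, hb]
      rw [hf] at h
      linear_combination (norm := module) h
    have hab : a - b ≠ 0 := by
      intro h0
      rw [h0, zero_smul] at hzC
      refine hcon ⟨e⁻¹ * (f / p d), ?_⟩
      have : e • U A = (f / p d) • V A := sub_eq_zero.1 hzC
      rw [mul_smul, ← this, smul_smul, inv_mul_cancel₀ he.ne', one_smul]
    exact Submodule.mem_span_singleton.2 ⟨(a - b)⁻¹, by
      rw [hzC, smul_smul, inv_mul_cancel₀ hab, one_smul]⟩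
  have single : ∀ i ∈ A, U {i} ∈ Submodule.span ℝ {z} := by
    intro i hi
    obtain ⟨j, k, hj, hk, hjk⟩ := Finset.one_lt_card_iff.1
      (show 1 < (A.erase i).card by rw [Finset.card_erase_of_mem hi]; omega)
    rw [Finset.mem_erase] at hj hk
    have p1 := pairs {i, j} (by simp [Finset.insert_subset_iff, hi, hj.2])
      (Finset.card_pair hj.1.symm)
    have p2 := pairs {i, k} (by simp [Finset.insert_subset_iff, hi, hk.2])
      (Finset.card_pair hk.1.symm)
    have p3 := pairs {j, k} (by simp [Finset.insert_subset_iff, hj.2, hk.2])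
      (Finset.card_pair hjk)
    simp only [hV, Finset.sum_pair hj.1.symm, Finset.sum_pair hk.1.symm,
      Finset.sum_pair hjk] at p1 p2 p3
    -- The three pairs in `{i, j, k}` isolate one state: `V {i, j} + V {i, k} - V {j, k} = (2 * p i)
    -- • U {i}`. Everything then lies on the line of `z`, so `U A` is a multiple of `V A` after all.
    have e : U {i} = (2 * p i)⁻¹ • ((p i • U {i} + p j • U {j}) + (p i • U {i} + p k • U {k})
        - (p j • U {j} + p k • U {k})) := by
      have : (p i • U {i} + p j • U {j}) + (p i • U {i} + p k • U {k})
        - (p j • U {j} + p k • U {k}) = (2 * p i) • U {i} := by module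
      rw [this, smul_smul, inv_mul_cancel₀ (mul_pos two_pos (hp i)).ne', one_smul]
    rw [e]
    exact Submodule.smul_mem _ _ (Submodule.sub_mem _ (Submodule.add_mem _ p1 p2) p3)
  have zV : V A ∈ Submodule.span ℝ {z} :=
    Submodule.sum_mem _ fun i hi => Submodule.smul_mem _ _ (single i hi)
  obtain ⟨i, hi⟩ := hne
  obtain ⟨a, b, h⟩ := step i hi
  have zU : U A ∈ Submodule.span ℝ {z} := by
    rw [h]
    exact Submodule.add_mem _ (Submodule.smul_mem _ _ zV) (Submodule.smul_mem _ _ (single i hi))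
  obtain ⟨s, hs⟩ := Submodule.mem_span_singleton.1 zV
  obtain ⟨t, ht⟩ := Submodule.mem_span_singleton.1 zU
  have hs0 : s ≠ 0 := by
    rintro rfl
    exact VA (by rw [← hs]; simp)
  refine hcon ⟨t * s⁻¹, ?_⟩
  rw [show (∑ i ∈ A, p i • U {i}) = V A from rfl, ← hs, smul_smul, mul_assoc,
    inv_mul_cancel₀ hs0, mul_one, ht]

/-- A family of intermediate vectors that does not lie in a plane consists of the weighted
averages of its vectors at single states, for one positive weight on the states. -/
theorem IsBetweenFamily.exists_weights (hU : IsBetweenFamily φ U)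
    (hT : ∀ x y : E, ∃ d, U {d} ∉ Submodule.span ℝ {x, y}) :
    ∃ p : Ω → ℝ, (∀ i, 0 < p i) ∧
      ∀ A : Finset Ω, A.Nonempty → (∑ i ∈ A, p i) • U A = ∑ i ∈ A, p i • U {i} := by
  obtain ⟨p, hp, hpair⟩ := hU.exists_pair_weights hT
  refine ⟨p, hp, fun A hA => ?_⟩
  obtain ⟨c, hc⟩ := hU.eq_smul_sum hT hp hpair _ A rfl hA
  have h : c * ∑ i ∈ A, p i = 1 := by
    have := congrArg φ hc
    rw [hU.height A hA] at this
    simpa [hU.height] using this.symm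
  rw [hc, smul_smul, mul_comm, h, one_smul]

end Weights

end StateDep

namespace StateDep

/-! ### The von Neumann-Morgenstern theorem through the cone of preferred directions. -/

section VNM

variable {M : Type*} [Fintype M]

/-- A sum-zero vector is a positive multiple of a difference of two lotteries, which may be chosen
around the same centre for two vectors. -/
lemma exists_lottery_add_smul [Nonempty M] (v w : M → ℝ) (hv : ∑ m, v m = 0) (hw : ∑ m, w m = 0) :
    ∃ (t : ℝ) (x y z : Lottery M), 0 < t ∧ (x : M → ℝ) - y = t • v ∧ (y : M → ℝ) - z = t • w := by
  have hN : (0 : ℝ) < Fintype.card M := by exact_mod_cast Fintype.card_pos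
  set N : ℝ := (Fintype.card M : ℝ)
  -- `B` bounds all coordinates, so a perturbation of the uniform lottery scaled by `(N * B)⁻¹`
  -- moves each weight by at most `N⁻¹`.
  set B : ℝ := 1 + ∑ m, (|v m| + |w m|) with hB
  have hB0 : 0 < B := by positivity
  have hle : ∀ m, |v m| ≤ B ∧ |w m| ≤ B := fun m => by
    have := Finset.single_le_sum (f := fun m => |v m| + |w m|) (fun i _ => by positivity)
      (Finset.mem_univ m)
    constructor <;> linarith [abs_nonneg (v m), abs_nonneg (w m)]
  have hconst : ∑ _m : M, N⁻¹ = 1 := by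
    simp [Finset.sum_const, N]
  have bound : ∀ s : ℝ, |s| ≤ B → -N⁻¹ ≤ (N * B)⁻¹ * s ∧ (N * B)⁻¹ * s ≤ N⁻¹ := by
    intro s hs
    have e : N⁻¹ = (N * B)⁻¹ * B := by field_simp
    have hpos : 0 < (N * B)⁻¹ := by positivity
    rw [abs_le] at hs
    constructor
    · rw [e, ← mul_neg]; exact mul_le_mul_of_nonneg_left hs.1 hpos.le
    · exact (mul_le_mul_of_nonneg_left hs.2 hpos.le).trans_eq e.symm
  refine ⟨(N * B)⁻¹, ⟨fun m => N⁻¹ + (N * B)⁻¹ * v m, fun m => ?_, ?_⟩,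
    ⟨fun _ => N⁻¹, fun m => by positivity, hconst⟩,
    ⟨fun m => N⁻¹ - (N * B)⁻¹ * w m, fun m => ?_, ?_⟩, by positivity, ?_, ?_⟩
  · linarith [(bound _ (hle m).1).1]
  · rw [Finset.sum_add_distrib, hconst, ← Finset.mul_sum, hv]; simp
  · linarith [(bound _ (hle m).2).2]
  · rw [Finset.sum_sub_distrib, hconst, ← Finset.mul_sum, hw]; simp
  · ext m; exact add_sub_cancel_left _ _
  · ext m; exact sub_sub_cancel _ _

lemma Lottery.nonempty (x : Lottery M) : Nonempty M := by
  by_contra h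
  rw [not_nonempty_iff] at h
  simpa using x.2.2

/-- The vectors that are positive multiples of a difference `x - y` with `x` weakly preferred
to `y`. -/
def PrefCone (r : Lottery M → Lottery M → Prop) (v : M → ℝ) : Prop :=
  ∃ (t : ℝ) (x y : Lottery M), 0 < t ∧ r x y ∧ (x : M → ℝ) - y = t • v

variable {r : Lottery M → Lottery M → Prop}

/-- Only the direction of `x - y` matters: with weights proportional to `s` and `t`, mixing `x, y`
with `y'` and mixing `x', y'` with `y` produces the same two lotteries. -/
lemma rel_iff_of_smul_sub_eq
    (hind : ∀ (x y z : Lottery M) (α : Set.Ioo (0 : ℝ) 1), r x y ↔ r (mix α x z) (mix α y z))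
    {x y x' y' : Lottery M} {s t : ℝ} (hs : 0 < s) (ht : 0 < t)
    (h : s • ((x : M → ℝ) - y) = t • ((x' : M → ℝ) - y')) : r x y ↔ r x' y' := by
  have hst : 0 < s + t := by positivity
  let α : Set.Ioo (0 : ℝ) 1 := ⟨s / (s + t), by positivity, by rw [div_lt_one hst]; linarith⟩
  let β : Set.Ioo (0 : ℝ) 1 := ⟨t / (s + t), by positivity, by rw [div_lt_one hst]; linarith⟩
  have hα : (α : ℝ) = s / (s + t) := rfl
  have hβ : (β : ℝ) = t / (s + t) := rfl
  have e : ∀ m, s * ((x : M → ℝ) m - (y : M → ℝ) m) = t * ((x' : M → ℝ) m - (y' : M → ℝ) m) :=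
    fun m => by simpa using congrFun h m
  have e1 : mix α x y' = mix β x' y := by
    apply Subtype.ext
    funext m
    have := e m
    simp only [mix, Pi.add_apply, Pi.smul_apply, smul_eq_mul, hα, hβ]
    field_simp
    linear_combination this
  have e2 : mix α y y' = mix β y' y := by
    apply Subtype.ext
    funext m
    simp only [mix, Pi.add_apply, Pi.smul_apply, smul_eq_mul, hα, hβ]
    field_simp
    ring
  rw [hind x y y' α, hind x' y' y β, e1, e2]

/-- The von Neumann-Morgenstern axioms for a relation on lotteries. -/
structure IsVNM (r : Lottery M → Lottery M → Prop) : Prop where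
  total : ∀ x y, r x y ∨ r y x
  trans : ∀ x y z, r x y → r y z → r x z
  cont : ∀ x y z, r x y ∧ ¬ r y x → r y z ∧ ¬ r z y →
    ∃ α β : Set.Ioo (0 : ℝ) 1, r (mix α x z) y ∧ r y (mix β x z)
  ind : ∀ (x y z : Lottery M) (α : Set.Ioo (0 : ℝ) 1), r x y ↔ r (mix α x z) (mix α y z)

namespace IsVNM

lemma prefCone_smul_sub_iff (hr : IsVNM r) {x y : Lottery M} {t : ℝ} (ht : 0 < t) {v : M → ℝ}
    (hv : (x : M → ℝ) - y = t • v) : PrefCone r v ↔ r x y := by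
  constructor
  · rintro ⟨s, x', y', hs, h, e⟩
    refine (rel_iff_of_smul_sub_eq hr.ind hs ht ?_).2 h
    rw [hv, e, smul_smul, smul_smul, mul_comm]
  · exact fun h => ⟨t, x, y, ht, h, hv⟩

lemma prefCone_sub_iff (hr : IsVNM r) (x y : Lottery M) :
    PrefCone r ((x : M → ℝ) - y) ↔ r x y :=
  hr.prefCone_smul_sub_iff one_pos (one_smul _ _).symm

lemma prefCone_smul {v : M → ℝ} (hv : PrefCone r v) {s : ℝ} (hs : 0 < s) :
    PrefCone r (s • v) := by
  obtain ⟨t, x, y, ht, h, e⟩ := hv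
  exact ⟨t / s, x, y, by positivity, h, by rw [e, smul_smul, div_mul_cancel₀ _ hs.ne']⟩

lemma sum_eq_zero_of_prefCone {v : M → ℝ} (hv : PrefCone r v) : ∑ m, v m = 0 := by
  obtain ⟨t, x, y, ht, -, e⟩ := hv
  have h : ∑ m, (t • v) m = 0 := by
    rw [← e]
    simp only [Pi.sub_apply, Finset.sum_sub_distrib]
    rw [stdSimplex.sum_eq_one, stdSimplex.sum_eq_one, sub_self]
  simp only [Pi.smul_apply, smul_eq_mul, ← Finset.mul_sum] at h
  exact (mul_eq_zero.1 h).resolve_left ht.ne'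

/-- This is transitivity, once both vectors are realized as `x - y` and `y - z` with a common `y`.
-/
lemma prefCone_add (hr : IsVNM r) {v w : M → ℝ} (hv : PrefCone r v) (hw : PrefCone r w) :
    PrefCone r (v + w) := by
  obtain ⟨-, l, -⟩ := id hv
  have := l.nonempty
  obtain ⟨t, x, y, z, ht, e1, e2⟩ := exists_lottery_add_smul v w (sum_eq_zero_of_prefCone hv)
    (sum_eq_zero_of_prefCone hw)
  refine (hr.prefCone_smul_sub_iff ht (x := x) (y := z) ?_).2 (hr.trans _ y _
    ((hr.prefCone_smul_sub_iff ht e1).1 hv) ((hr.prefCone_smul_sub_iff ht e2).1 hw))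
  rw [smul_add, ← e1, ← e2]; abel

lemma prefCone_total [Nonempty M] (hr : IsVNM r) {v : M → ℝ} (hv : ∑ m, v m = 0) :
    PrefCone r v ∨ PrefCone r (-v) := by
  obtain ⟨t, x, y, z, ht, e1, -⟩ := exists_lottery_add_smul v v hv hv
  rcases hr.total x y with h | h
  · exact Or.inl ⟨t, x, y, ht, h, e1⟩
  · exact Or.inr ⟨t, y, x, ht, h, by rw [smul_neg, ← e1]; abel⟩

/-- The Archimedean property of the preference cone. -/
lemma exists_prefCone_sub_smul (hr : IsVNM r) {a b : M → ℝ} (ha : PrefCone r a)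
    (ha' : ¬ PrefCone r (-a)) (hb : PrefCone r b) (hb' : ¬ PrefCone r (-b)) :
    ∃ s : ℝ, 0 < s ∧ PrefCone r (b - s • a) := by
  obtain ⟨-, l, -⟩ := id ha
  have := l.nonempty
  obtain ⟨t, x, y, z, ht, e1, e2⟩ := exists_lottery_add_smul b a (sum_eq_zero_of_prefCone hb)
    (sum_eq_zero_of_prefCone ha)
  have e1' : (y : M → ℝ) - x = t • (-b) := by rw [smul_neg, ← e1]; abel
  have e2' : (z : M → ℝ) - y = t • (-a) := by rw [smul_neg, ← e2]; abel
  rw [hr.prefCone_smul_sub_iff ht e1'] at hb'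
  rw [hr.prefCone_smul_sub_iff ht e2'] at ha'
  obtain ⟨α, -, h, -⟩ := hr.cont x y z ⟨(hr.prefCone_smul_sub_iff ht e1).1 hb, hb'⟩
    ⟨(hr.prefCone_smul_sub_iff ht e2).1 ha, ha'⟩
  have h0 := α.2.1
  have h1 := α.2.2
  have h1' : 0 < 1 - (α : ℝ) := by linarith
  -- With `x = y + t • b` and `z = y - t • a`, the mixture minus `y` is `t * α` times `b - ((1 - α)
  -- / α) • a`.
  refine ⟨(1 - α) / α, by positivity, t * α, mix α x z, y, by positivity, h, ?_⟩
  have e3 : (α : ℝ) * ((1 - α) / α) = 1 - α := by field_simp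
  have hx : (x : M → ℝ) = t • b + y := by rw [← e1]; abel
  have hz : (z : M → ℝ) = y - t • a := by rw [← e2]; abel
  have e4 : (t * (α : ℝ)) • (b - ((1 - (α : ℝ)) / α) • a) =
      (t * α) • b - (t * ((α : ℝ) * ((1 - α) / α))) • a := by module
  rw [e4, e3]
  have e5 : (mix α x z : M → ℝ) = (α : ℝ) • (x : M → ℝ) + (1 - (α : ℝ)) • (z : M → ℝ) := rfl
  rw [e5, hx, hz]
  module

/-- The vectors neutral for the preference form a linear subspace. -/
def neutral (hr : IsVNM r) (l : Lottery M) : Submodule ℝ (M → ℝ) where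
  carrier := {v | PrefCone r v ∧ PrefCone r (-v)}
  add_mem' := fun hv hw => ⟨hr.prefCone_add hv.1 hw.1, by
    rw [neg_add]; exact hr.prefCone_add hv.2 hw.2⟩
  zero_mem' := by
    have h : r l l := (hr.total l l).elim id id
    have : PrefCone r (0 : M → ℝ) := by
      have := (hr.prefCone_sub_iff l l).2 h
      rwa [sub_self] at this
    exact ⟨this, by rwa [neg_zero]⟩
  smul_mem' := by
    intro c v hv
    have h : r l l := (hr.total l l).elim id id
    rcases lt_trichotomy c 0 with hc | rfl | hc
    · have e : c • v = (-c) • (-v) := by module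
      have e' : -(c • v) = (-c) • v := by module
      exact ⟨e ▸ prefCone_smul hv.2 (by linarith), e' ▸ prefCone_smul hv.1 (by linarith)⟩
    · have : PrefCone r (0 : M → ℝ) := by
        have := (hr.prefCone_sub_iff l l).2 h
        rwa [sub_self] at this
      exact ⟨by rwa [zero_smul], by rwa [zero_smul, neg_zero]⟩
    · exact ⟨prefCone_smul hv.1 hc, by rw [← smul_neg]; exact prefCone_smul hv.2 hc⟩

/-- The coefficient is the supremum of the `t` with `v - t • d` in the cone. A strictly ranked
remainder at the supremum, of either sign, would leave room to move by the Archimedean property. -/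
lemma exists_sub_smul_mem_neutral_of_pos (hr : IsVNM r) (l : Lottery M) {d v : M → ℝ}
    (hd : PrefCone r d) (hd' : ¬ PrefCone r (-d)) (hv : PrefCone r v) (hv' : ¬ PrefCone r (-v)) :
    ∃ t : ℝ, v - t • d ∈ hr.neutral l := by
  have := l.nonempty
  have neg_of : ∀ {c : ℝ}, PrefCone r (c • d) → 0 ≤ c := by
    intro c hc
    by_contra hneg
    push Not at hneg
    refine hd' ?_
    have := prefCone_smul hc (s := -c⁻¹) (by
      rw [neg_pos]; exact inv_lt_zero.2 hneg)
    rwa [smul_smul, neg_mul, inv_mul_cancel₀ hneg.ne, neg_one_smul] at this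
  set S : Set ℝ := {t | PrefCone r (v - t • d)} with hS
  have h0 : (0 : ℝ) ∈ S := by simpa [hS] using hv
  obtain ⟨s, hs, hsv⟩ := hr.exists_prefCone_sub_smul hv hv' hd hd'
  have hbdd : BddAbove S := by
    refine ⟨s⁻¹, fun t ht => ?_⟩
    have h2 := hr.prefCone_add ht (prefCone_smul hsv (inv_pos.2 hs))
    have e : v - t • d + s⁻¹ • (d - s • v) = (s⁻¹ - t) • d := by
      have : s⁻¹ • (d - s • v) = s⁻¹ • d - (s⁻¹ * s) • v := by module
      rw [this, inv_mul_cancel₀ hs.ne']; module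
    rw [e] at h2
    linarith [neg_of h2]
  refine ⟨sSup S, ?_⟩
  have hsum : ∑ m, (v - sSup S • d) m = 0 := by
    simp [← Finset.mul_sum, sum_eq_zero_of_prefCone hv, sum_eq_zero_of_prefCone hd]
  by_cases c1 : PrefCone r (v - sSup S • d)
  · by_cases c2 : PrefCone r (-(v - sSup S • d))
    · exact ⟨c1, c2⟩
    · exfalso
      obtain ⟨q, hq, h⟩ := hr.exists_prefCone_sub_smul hd hd' c1 c2
      have : sSup S + q ∈ S := by
        have e : v - (sSup S + q) • d = v - sSup S • d - q • d := by module
        change PrefCone r (v - (sSup S + q) • d)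
        rwa [e]
      linarith [le_csSup hbdd this]
  · exfalso
    have c2 := (hr.prefCone_total hsum).resolve_left c1
    obtain ⟨q, hq, h⟩ := hr.exists_prefCone_sub_smul hd hd' c2 (by rwa [neg_neg])
    obtain ⟨t, ht, hlt⟩ := exists_lt_of_lt_csSup ⟨0, h0⟩ (show sSup S - q < sSup S by linarith)
    have h2 := hr.prefCone_add ht h
    have e : v - t • d + (-(v - sSup S • d) - q • d) = (sSup S - q - t) • d := by module
    rw [e] at h2
    linarith [neg_of h2]

lemma exists_sub_smul_mem_neutral (hr : IsVNM r) (l : Lottery M) {d v : M → ℝ}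
    (hd : PrefCone r d) (hd' : ¬ PrefCone r (-d)) (hv : ∑ m, v m = 0) :
    ∃ t : ℝ, v - t • d ∈ hr.neutral l := by
  have := l.nonempty
  by_cases c1 : PrefCone r v
  · by_cases c2 : PrefCone r (-v)
    · exact ⟨0, by rw [zero_smul, sub_zero]; exact ⟨c1, c2⟩⟩
    · exact hr.exists_sub_smul_mem_neutral_of_pos l hd hd' c1 c2
  · have c2 := (hr.prefCone_total hv).resolve_left c1
    obtain ⟨t, ht⟩ := hr.exists_sub_smul_mem_neutral_of_pos l hd hd' c2 (by rwa [neg_neg])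
    refine ⟨-t, ?_⟩
    have e : v - (-t) • d = -(-v - t • d) := by module
    rw [e]
    exact Submodule.neg_mem _ ht

/-- The von Neumann-Morgenstern theorem, with the utility normalized at two strictly ranked
lotteries. -/
theorem exists_utility (hr : IsVNM r) {h l : Lottery M} (hl : r h l) (hl' : ¬ r l h) :
    ∃ U : M → ℝ, (∀ x y : Lottery M, r x y ↔ (y : M → ℝ) ⬝ᵥ U ≤ (x : M → ℝ) ⬝ᵥ U) ∧
      (h : M → ℝ) ⬝ᵥ U = 1 ∧ (l : M → ℝ) ⬝ᵥ U = 0 := by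
  classical
  set d : M → ℝ := (h : M → ℝ) - l with hdef
  have hd : PrefCone r d := (hr.prefCone_sub_iff h l).2 hl
  have hd' : ¬ PrefCone r (-d) := by
    rw [hdef, neg_sub, hr.prefCone_sub_iff]; exact hl'
  -- The utility of `m` is the coefficient along `d` of the degenerate lottery at `m` minus `l`,
  -- modulo neutral vectors. Linearity in the lottery is then automatic.
  have hex : ∀ m : M, ∃ t : ℝ, (Pi.single m 1 - (l : M → ℝ)) - t • d ∈ hr.neutral l := fun m =>
    hr.exists_sub_smul_mem_neutral l hd hd' (by
      simp only [Pi.sub_apply, Finset.sum_sub_distrib]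
      rw [stdSimplex.sum_eq_one]; simp)
  choose U hU using hex
  have key : ∀ x : Lottery M, ((x : M → ℝ) - l) - ((x : M → ℝ) ⬝ᵥ U) • d ∈ hr.neutral l := by
    intro x
    have e : ((x : M → ℝ) - l) - ((x : M → ℝ) ⬝ᵥ U) • d =
        ∑ m, (x : M → ℝ) m • ((Pi.single m 1 - (l : M → ℝ)) - U m • d) := by
      simp only [smul_sub, Finset.sum_sub_distrib, smul_smul, ← Finset.sum_smul]
      rw [stdSimplex.sum_eq_one, one_smul]
      congr 2
      exact pi_eq_sum_univ' (x : M → ℝ)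
    rw [e]
    exact Submodule.sum_mem _ fun m _ => Submodule.smul_mem _ _ (hU m)
  have cone_iff : ∀ c : ℝ, PrefCone r (c • d) ↔ 0 ≤ c := by
    intro c
    constructor
    · intro hc
      by_contra hneg
      push Not at hneg
      refine hd' ?_
      have := prefCone_smul hc (s := -c⁻¹) (by rw [neg_pos]; exact inv_lt_zero.2 hneg)
      rwa [smul_smul, neg_mul, inv_mul_cancel₀ hneg.ne, neg_one_smul] at this
    · intro hc
      rcases hc.eq_or_lt with rfl | hc
      · rw [zero_smul]; exact (hr.neutral l).zero_mem.1
      · exact prefCone_smul hd hc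
  have neutral_smul : ∀ c : ℝ, c • d ∈ hr.neutral l → c = 0 := by
    intro c hc
    have h1 := (cone_iff c).1 hc.1
    have h2 := (cone_iff (-c)).1 (by rw [neg_smul]; exact hc.2)
    linarith
  refine ⟨U, fun x y => ?_, ?_, ?_⟩
  · have hn := Submodule.sub_mem _ (key x) (key y)
    set n := ((x : M → ℝ) - l) - ((x : M → ℝ) ⬝ᵥ U) • d - (((y : M → ℝ) - l) -
      ((y : M → ℝ) ⬝ᵥ U) • d) with hn_def
    have e : (x : M → ℝ) - y = ((x : M → ℝ) ⬝ᵥ U - (y : M → ℝ) ⬝ᵥ U) • d + n := by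
      rw [hn_def]; module
    rw [← hr.prefCone_sub_iff, ← sub_nonneg, ← cone_iff]
    constructor
    · intro hc
      have := hr.prefCone_add hc hn.2
      rwa [e, add_neg_cancel_right] at this
    · intro hc
      rw [e]
      exact hr.prefCone_add hc hn.1
  · have := key h
    have e : ((h : M → ℝ) - l) - ((h : M → ℝ) ⬝ᵥ U) • d = (1 - (h : M → ℝ) ⬝ᵥ U) • d := by
      rw [hdef]; module
    rw [e] at this
    linarith [neutral_smul _ this]
  · have := key l
    have e : ((l : M → ℝ) - l) - ((l : M → ℝ) ⬝ᵥ U) • d = (-((l : M → ℝ) ⬝ᵥ U)) • d := by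
      module
    rw [e] at this
    linarith [neutral_smul _ this]

end IsVNM

end VNM

end StateDep

namespace StateDep

/-! ### Comparing and aggregating normalized utilities. -/

section Duality

variable {M : Type*} [Fintype M]

lemma eq_of_dotProduct_eq {U U' : M → ℝ} (h : ∀ v : M → ℝ, v ⬝ᵥ U = v ⬝ᵥ U') : U = U' := by
  classical
  funext m
  simpa using h (Pi.single m 1)

/-- Every vector acts as a positive multiple of a difference of two lotteries on the utilities
that vanish at a given lottery. -/
lemma exists_lottery_dotProduct_sub (l : Lottery M) (v : M → ℝ) :
    ∃ (t : ℝ) (x y : Lottery M), 0 < t ∧ ∀ U : M → ℝ, (l : M → ℝ) ⬝ᵥ U = 0 →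
      (x : M → ℝ) ⬝ᵥ U - (y : M → ℝ) ⬝ᵥ U = t * (v ⬝ᵥ U) := by
  have := l.nonempty
  -- Subtracting a multiple of `l` makes the sum zero and is invisible to every `U` that vanishes at
  -- `l`.
  have h0 : ∑ m, (v - (∑ m, v m) • (l : M → ℝ)) m = 0 := by
    simp only [Pi.sub_apply, Pi.smul_apply, smul_eq_mul, Finset.sum_sub_distrib, ← Finset.mul_sum]
    rw [stdSimplex.sum_eq_one]; simp
  obtain ⟨t, x, y, -, ht, e, -⟩ := exists_lottery_add_smul _ _ h0 h0
  refine ⟨t, x, y, ht, fun U hU => ?_⟩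
  rw [← sub_dotProduct, e, smul_dotProduct, sub_dotProduct, smul_dotProduct, hU]
  simp

/-- A normalized functional that is nonnegative wherever a normalized one is equals it. -/
lemma eq_of_nonneg_imp {U U' d : M → ℝ} (hd : d ⬝ᵥ U = 1) (hd' : d ⬝ᵥ U' = 1)
    (h : ∀ v : M → ℝ, 0 ≤ v ⬝ᵥ U → 0 ≤ v ⬝ᵥ U') : U = U' := by
  refine eq_of_dotProduct_eq fun v => ?_
  have h1 := h (v - (v ⬝ᵥ U) • d) (by simp [sub_dotProduct, hd])
  have h2 := h (-(v - (v ⬝ᵥ U) • d)) (by simp [sub_dotProduct, hd])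
  simp only [neg_dotProduct, sub_dotProduct, smul_dotProduct, hd', smul_eq_mul] at h1 h2
  linarith

/-- Harsanyi aggregation of two normalized functionals, with strictly positive weights. -/
lemma exists_pos_combination {U₁ U₂ U d : M → ℝ} (hd₁ : d ⬝ᵥ U₁ = 1) (hd₂ : d ⬝ᵥ U₂ = 1)
    (hd : d ⬝ᵥ U = 1)
    (h : ∀ v : M → ℝ, 0 ≤ v ⬝ᵥ U₁ → 0 ≤ v ⬝ᵥ U₂ → 0 ≤ v ⬝ᵥ U)
    (h₁ : ∀ v : M → ℝ, 0 < v ⬝ᵥ U₁ → 0 ≤ v ⬝ᵥ U₂ → 0 < v ⬝ᵥ U)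
    (h₂ : ∀ v : M → ℝ, 0 ≤ v ⬝ᵥ U₁ → 0 < v ⬝ᵥ U₂ → 0 < v ⬝ᵥ U) :
    ∃ a b : ℝ, 0 < a ∧ 0 < b ∧ U = a • U₁ + b • U₂ := by
  by_cases heq : U₁ = U₂
  · subst heq
    have : U₁ = U := eq_of_nonneg_imp hd₁ hd fun v hv => h v hv hv
    refine ⟨1 / 2, 1 / 2, by norm_num, by norm_num, ?_⟩
    rw [← this]; module
  obtain ⟨v, hv⟩ : ∃ v : M → ℝ, v ⬝ᵥ U₁ ≠ v ⬝ᵥ U₂ := by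
    by_contra hcon
    push Not at hcon
    exact heq (eq_of_dotProduct_eq hcon)
  have hne : v ⬝ᵥ U₁ - v ⬝ᵥ U₂ ≠ 0 := sub_ne_zero.2 hv
  -- `e` separates the two functionals, with values 1 and 0, so `e ⬝ᵥ U` must be the weight of `U₁`.
  -- Strict Pareto at `e` and at `d - e` makes both weights positive.
  set e := (v ⬝ᵥ U₁ - v ⬝ᵥ U₂)⁻¹ • (v - (v ⬝ᵥ U₂) • d) with he
  have e₁ : e ⬝ᵥ U₁ = 1 := by
    rw [he, smul_dotProduct, sub_dotProduct, smul_dotProduct, hd₁, smul_eq_mul, smul_eq_mul,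
      mul_one, inv_mul_cancel₀ hne]
  have e₂ : e ⬝ᵥ U₂ = 0 := by
    rw [he, smul_dotProduct, sub_dotProduct, smul_dotProduct, hd₂]
    simp
  have p1 := h₁ e (by rw [e₁]; norm_num) e₂.ge
  have p2 := h₂ (d - e) (by simp [sub_dotProduct, hd₁, e₁]) (by simp [sub_dotProduct, hd₂, e₂])
  have p2' : 0 < 1 - e ⬝ᵥ U := by simpa [sub_dotProduct, hd] using p2
  refine ⟨e ⬝ᵥ U, 1 - e ⬝ᵥ U, p1, p2', eq_of_dotProduct_eq fun w => ?_⟩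
  set z := w - (w ⬝ᵥ U₁ - w ⬝ᵥ U₂) • e - (w ⬝ᵥ U₂) • d with hz
  have hzU : ∀ Y : M → ℝ, z ⬝ᵥ Y =
      w ⬝ᵥ Y - (w ⬝ᵥ U₁ - w ⬝ᵥ U₂) * (e ⬝ᵥ Y) - (w ⬝ᵥ U₂) * (d ⬝ᵥ Y) := fun Y => by
    simp [hz, sub_dotProduct]
  have z₁ : z ⬝ᵥ U₁ = 0 := by rw [hzU, e₁, hd₁]; ring
  have z₂ : z ⬝ᵥ U₂ = 0 := by rw [hzU, e₂, hd₂]; ring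
  have q1 := h z z₁.ge z₂.ge
  have q2 := h (-z) (by simp [z₁]) (by simp [z₂])
  rw [neg_dotProduct] at q2
  have q : z ⬝ᵥ U = 0 := by linarith
  rw [hzU, hd] at q
  simp only [dotProduct_add, dotProduct_smul, smul_eq_mul]
  linarith

/-- A normalized utility representation is unique. -/
lemma utility_unique {r : Lottery M → Lottery M → Prop} {h l : Lottery M} {U U' : M → ℝ}
    (hU : ∀ x y : Lottery M, r x y ↔ (y : M → ℝ) ⬝ᵥ U ≤ (x : M → ℝ) ⬝ᵥ U)
    (hU' : ∀ x y : Lottery M, r x y ↔ (y : M → ℝ) ⬝ᵥ U' ≤ (x : M → ℝ) ⬝ᵥ U')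
    (h1 : (h : M → ℝ) ⬝ᵥ U = 1) (h1' : (h : M → ℝ) ⬝ᵥ U' = 1)
    (l0 : (l : M → ℝ) ⬝ᵥ U = 0) (l0' : (l : M → ℝ) ⬝ᵥ U' = 0) : U = U' := by
  refine eq_of_nonneg_imp h1 h1' fun v hv => ?_
  obtain ⟨t, x, y, ht, e⟩ := exists_lottery_dotProduct_sub l v
  have h2 : r x y := (hU x y).2 (by
    have := mul_nonneg ht.le hv
    rw [← e U l0] at this; linarith)
  have h3 := (hU' x y).1 h2
  rw [← sub_nonneg, e U' l0'] at h3
  exact nonneg_of_mul_nonneg_right h3 ht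

end Duality

/-! ### Linear independence from richness. -/

section Plane

variable {E : Type*} [AddCommGroup E] [Module ℝ E]

/-- Three independent vectors do not lie in a plane. -/
lemma IndepTriple.not_subset_span_pair {t₁ t₂ t₃ x y : E} (h : IndepTriple t₁ t₂ t₃)
    (h₁ : t₁ ∈ Submodule.span ℝ {x, y}) (h₂ : t₂ ∈ Submodule.span ℝ {x, y})
    (h₃ : t₃ ∈ Submodule.span ℝ {x, y}) : False := by
  obtain ⟨a₁, b₁, rfl⟩ := Submodule.mem_span_pair.1 h₁
  obtain ⟨a₂, b₂, rfl⟩ := Submodule.mem_span_pair.1 h₂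
  obtain ⟨a₃, b₃, rfl⟩ := Submodule.mem_span_pair.1 h₃
  -- The two-by-two minors of the coordinates are the coefficients of a linear relation among three
  -- vectors of a plane.
  obtain ⟨-, -, h12⟩ := h (a₂ * b₃ - a₃ * b₂) (a₃ * b₁ - a₁ * b₃) (a₁ * b₂ - a₂ * b₁) (by module)
  obtain ⟨-, hb, -⟩ := h b₂ (-b₁) 0 (by
    linear_combination (norm := module) h12 • x)
  obtain ⟨-, ha, -⟩ := h a₂ (-a₁) 0 (by
    linear_combination (norm := module) (-h12) • y)
  have hb' : b₁ = 0 := by linarith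
  have ha' : a₁ = 0 := by linarith
  have := (h 1 0 0 (by rw [ha', hb']; module)).1
  norm_num at this

lemma sign_conditions {p n n' a b c : ℝ} (hp : 0 < p) (hn : n ≤ 0) (hn' : n' ≤ 0)
    (h : a * p + b * n + c * n' = 0) : (0 < a → b ≤ 0 → c ≤ 0 → False) ∧
      (a < 0 → 0 ≤ b → 0 ≤ c → False) := by
  constructor
  · intro ha hb hc
    linarith [mul_pos ha hp, mul_nonneg_of_nonpos_of_nonpos hb hn,
      mul_nonneg_of_nonpos_of_nonpos hc hn']
  · intro ha hb hc
    linarith [mul_neg_of_neg_of_pos ha hp, mul_nonpos_of_nonneg_of_nonpos hb hn,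
      mul_nonpos_of_nonneg_of_nonpos hc hn']

/-- Three normalized functionals, each of which is separated from the two others, are linearly
independent. -/
lemma indepTriple_of_separated {M : Type*} [Fintype M] {U₁ U₂ U₃ d v₁ v₂ v₃ : M → ℝ}
    (d₁ : d ⬝ᵥ U₁ = 1) (d₂ : d ⬝ᵥ U₂ = 1) (d₃ : d ⬝ᵥ U₃ = 1)
    (h₁ : 0 < v₁ ⬝ᵥ U₁ ∧ v₁ ⬝ᵥ U₂ ≤ 0 ∧ v₁ ⬝ᵥ U₃ ≤ 0)
    (h₂ : 0 < v₂ ⬝ᵥ U₂ ∧ v₂ ⬝ᵥ U₁ ≤ 0 ∧ v₂ ⬝ᵥ U₃ ≤ 0)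
    (h₃ : 0 < v₃ ⬝ᵥ U₃ ∧ v₃ ⬝ᵥ U₁ ≤ 0 ∧ v₃ ⬝ᵥ U₂ ≤ 0) : IndepTriple U₁ U₂ U₃ := by
  intro a b c h
  have hdot : ∀ v : M → ℝ, a * (v ⬝ᵥ U₁) + b * (v ⬝ᵥ U₂) + c * (v ⬝ᵥ U₃) = 0 := fun v => by
    have := congrArg (fun w => v ⬝ᵥ w) h
    simpa [dotProduct_add, dotProduct_smul] using this
  have hsum : a + b + c = 0 := by simpa [d₁, d₂, d₃] using hdot d
  obtain ⟨s1, s1'⟩ := sign_conditions h₁.1 h₁.2.1 h₁.2.2 (hdot v₁)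
  obtain ⟨s2, s2'⟩ := sign_conditions (a := b) (b := a) h₂.1 h₂.2.1 h₂.2.2
    (by linarith [hdot v₂])
  obtain ⟨s3, s3'⟩ := sign_conditions (a := c) (b := a) (c := b) h₃.1 h₃.2.1 h₃.2.2
    (by linarith [hdot v₃])
  -- Coefficients with sum zero, not all zero, include one of strict sign with the two others weakly
  -- of the opposite sign, which `sign_conditions` excludes.
  grind

end Plane

/-! ### Uniqueness of the probability. -/

section Uniqueness

variable {Ω E : Type*} [Fintype Ω] [DecidableEq Ω] [AddCommGroup E] [Module ℝ E]
  {U : Finset Ω → E}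

/-- The probability that generates an intermediate family not lying in a plane is unique. -/
lemma posProb_unique
    (hT : ∀ x y : E, ∃ d, U {d} ∉ Submodule.span ℝ {x, y}) {p q : Ω → ℝ}
    (hp : IsPosProb p) (hq : IsPosProb q)
    (hpU : ∀ A : Finset Ω, A.Nonempty → (∑ i ∈ A, p i) • U A = ∑ i ∈ A, p i • U {i})
    (hqU : ∀ A : Finset Ω, A.Nonempty → (∑ i ∈ A, q i) • U A = ∑ i ∈ A, q i • U {i}) :
    q = p := by
  have key : ∀ {i j : Ω}, U {i} ≠ U {j} → q i * p j = q j * p i := by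
    intro i j hij
    have hne : i ≠ j := fun h => hij (by rw [h])
    have e1 := hpU {i, j} ⟨i, by simp⟩
    have e2 := hqU {i, j} ⟨i, by simp⟩
    rw [Finset.sum_pair hne, Finset.sum_pair hne] at e1 e2
    have e : (q j * p i - q i * p j) • (U {i} - U {j}) = 0 := by
      linear_combination (norm := module) (p i + p j) • e2 - (q i + q j) • e1
    rcases smul_eq_zero.1 e with h | h
    · linarith
    · exact absurd (sub_eq_zero.1 h) hij
  have cross : ∀ i j : Ω, q i * p j = q j * p i := by
    intro i j
    -- The pair event says nothing when the two vectors coincide; the ratio is then read off through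
    -- a third state `d`.
    by_cases hij : U {i} = U {j}
    · obtain ⟨d, hd⟩ := hT (U {i}) (U {j})
      obtain ⟨h1, h2⟩ := ne_of_notMem_span_pair hd
      have k1 := key h1
      have k2 := key h2
      refine mul_right_cancel₀ (hp.1 d).ne' ?_
      linear_combination p j * k1 - p i * k2
    · exact key hij
  funext i
  have := Finset.sum_congr (rfl : (Finset.univ : Finset Ω) = Finset.univ) fun j _ => cross i j
  rw [← Finset.mul_sum, ← Finset.sum_mul, hp.2, hq.2] at this
  linarith

end Uniqueness

/-! ### From the axioms on preferences to betweenness families. -/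

section Representation

variable {Ω M : Type*} [Fintype M]

lemma expUtil_eq_dotProduct (u : Ω → M → ℝ) (ω : Ω) (x : Lottery M) :
    expUtil u ω x = (x : M → ℝ) ⬝ᵥ u ω := rfl

lemma IsPosProb.sum_pos [Fintype Ω] {P : Ω → ℝ} (hP : IsPosProb P) (A : Event Ω) : 0 < ∑ ω ∈ A.1, P ω :=
  Finset.sum_pos (fun i _ => hP.1 i) A.2

lemma expUtil_affine {u w : Ω → M → ℝ} {a b : ℝ} (h : ∀ ω m, w ω m = a * u ω m + b) (ω : Ω)
    (x : Lottery M) : expUtil w ω x = a * expUtil u ω x + b := by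
  have hx : ∑ m, (x : M → ℝ) m = 1 := stdSimplex.sum_eq_one x
  simp only [expUtil, h]
  rw [Finset.mul_sum]
  calc ∑ m, (x : M → ℝ) m * (a * u ω m + b)
      = ∑ m, a * ((x : M → ℝ) m * u ω m) + (∑ m, (x : M → ℝ) m) * b := by
        rw [Finset.sum_mul, ← Finset.sum_add_distrib]
        exact Finset.sum_congr rfl fun m _ => by ring
    _ = _ := by rw [hx, one_mul]

variable [DecidableEq Ω]

lemma condExpUtil_eq_dotProduct (P : Ω → ℝ) (u : Ω → M → ℝ) (A : Event Ω) (x : Lottery M) :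
    condExpUtil P u A x =
      (x : M → ℝ) ⬝ᵥ ((∑ ω ∈ A.1, P ω)⁻¹ • ∑ ω ∈ A.1, P ω • u ω) := by
  rw [dotProduct_smul, dotProduct_sum, smul_eq_mul, Finset.mul_sum]
  refine Finset.sum_congr rfl fun ω hω => ?_
  rw [condProb, if_pos hω, dotProduct_smul, smul_eq_mul, expUtil_eq_dotProduct]
  ring

lemma sum_condProb [Fintype Ω] {P : Ω → ℝ} (hP : IsPosProb P) (A : Event Ω) :
    ∑ ω ∈ A.1, condProb P A ω = 1 := by
  have : ∀ ω ∈ A.1, condProb P A ω = P ω / ∑ ω' ∈ A.1, P ω' := fun ω hω => by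
    rw [condProb, if_pos hω]
  rw [Finset.sum_congr rfl this, ← Finset.sum_div, div_self (hP.sum_pos A).ne']

lemma condExpUtil_affine [Fintype Ω] {P : Ω → ℝ} (hP : IsPosProb P) {u w : Ω → M → ℝ} {a b : ℝ}
    (h : ∀ ω m, w ω m = a * u ω m + b) (A : Event Ω) (x : Lottery M) :
    condExpUtil P w A x = a * condExpUtil P u A x + b := by
  simp only [condExpUtil, expUtil_affine h]
  rw [Finset.mul_sum]
  calc ∑ ω ∈ A.1, condProb P A ω * (a * expUtil u ω x + b)
      = ∑ ω ∈ A.1, a * (condProb P A ω * expUtil u ω x) + (∑ ω ∈ A.1, condProb P A ω) * b := by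
        rw [Finset.sum_mul, ← Finset.sum_add_distrib]
        exact Finset.sum_congr rfl fun ω _ => by ring
    _ = _ := by rw [sum_condProb hP A, one_mul]

lemma condExpUtil_single [Fintype Ω] {P : Ω → ℝ} (hP : IsPosProb P) (u : Ω → M → ℝ) (ω : Ω)
    (x : Lottery M) : condExpUtil P u (Event.single ω) x = expUtil u ω x := by
  have h := sum_condProb hP (Event.single ω)
  simp only [Event.single, Finset.sum_singleton] at h
  simp [condExpUtil, Event.single, h]

lemma condExpUtil_const [Fintype Ω] {P : Ω → ℝ} (hP : IsPosProb P) {u : Ω → M → ℝ} {x : Lottery M} {c : ℝ}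
    (h : ∀ ω, expUtil u ω x = c) (A : Event Ω) : condExpUtil P u A x = c := by
  simp only [condExpUtil, h]
  rw [← Finset.sum_mul, sum_condProb hP, one_mul]

variable {R : CondAct Ω M → CondAct Ω M → Prop}

lemma isVNM_weakPref (hOrder : WeakOrder R) (hCont : VNMContinuity R) (hInd : Independence R)
    (A : Event Ω) : IsVNM (WeakPref R A) where
  total := (hOrder A).1
  trans := (hOrder A).2
  cont := hCont A
  ind := hInd A

lemma strictPref_of_single (hPareto : ExtendedPareto R) {x y : Lottery M}
    (h : ∀ ω, StrictPref R (Event.single ω) x y) (A : Event Ω) : StrictPref R A x y := by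
  obtain ⟨A, hA⟩ := A
  induction hA using Finset.Nonempty.cons_induction with
  | singleton a => exact h a
  | cons a s has hs ih =>
    have e : (⟨Finset.cons a s has, Finset.cons_nonempty has⟩ : Event Ω) =
        (Event.single a).union ⟨s, hs⟩ := Subtype.ext
      ((Finset.cons_eq_insert a s has).trans (Finset.insert_eq a s))
    rw [e]
    exact (hPareto _ _ (by simpa [Event.single] using has) x y).2 (h a) ih.1

lemma Event.union_comm (A B : Event Ω) : A.union B = B.union A :=
  Subtype.ext (Finset.union_comm _ _)

/-- Under extended Pareto, the normalized utility given a disjoint union is a strictly positive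
combination of the normalized utilities given its parts. -/
lemma exists_pos_combination_of_pareto (hPareto : ExtendedPareto R) {xhi xlo : Lottery M}
    {V : Event Ω → M → ℝ}
    (hV : ∀ A x y, WeakPref R A x y ↔ (y : M → ℝ) ⬝ᵥ V A ≤ (x : M → ℝ) ⬝ᵥ V A)
    (hhi : ∀ A, (xhi : M → ℝ) ⬝ᵥ V A = 1) (hlo : ∀ A, (xlo : M → ℝ) ⬝ᵥ V A = 0)
    {A B : Event Ω} (hAB : Disjoint A.1 B.1) :
    ∃ a b : ℝ, 0 < a ∧ 0 < b ∧ V (A.union B) = a • V A + b • V B := by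
  have weak : ∀ {A : Event Ω} {x y : Lottery M} {t : ℝ} {v : M → ℝ}, 0 < t →
      (∀ U : M → ℝ, (xlo : M → ℝ) ⬝ᵥ U = 0 →
        (x : M → ℝ) ⬝ᵥ U - (y : M → ℝ) ⬝ᵥ U = t * (v ⬝ᵥ U)) →
      (WeakPref R A x y ↔ 0 ≤ v ⬝ᵥ V A) := by
    intro A x y t v ht e
    rw [hV, ← sub_nonneg, e _ (hlo A), mul_nonneg_iff_of_pos_left ht]
  have strict : ∀ {A : Event Ω} {x y : Lottery M} {t : ℝ} {v : M → ℝ}, 0 < t →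
      (∀ U : M → ℝ, (xlo : M → ℝ) ⬝ᵥ U = 0 →
        (x : M → ℝ) ⬝ᵥ U - (y : M → ℝ) ⬝ᵥ U = t * (v ⬝ᵥ U)) →
      (StrictPref R A x y ↔ 0 < v ⬝ᵥ V A) := by
    intro A x y t v ht e
    rw [StrictPref, hV, hV, ← lt_iff_le_not_ge, ← sub_pos, e _ (hlo A), mul_pos_iff_of_pos_left ht]
  refine exists_pos_combination (hhi A) (hhi B) (hhi _) (fun v h1 h2 => ?_) (fun v h1 h2 => ?_)
    (fun v h1 h2 => ?_) <;>
  obtain ⟨t, x, y, ht, e⟩ := exists_lottery_dotProduct_sub xlo v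
  · exact (weak ht e).1 ((hPareto A B hAB x y).1 ((weak ht e).2 h1) ((weak ht e).2 h2))
  · exact (strict ht e).1 ((hPareto A B hAB x y).2 ((strict ht e).2 h1) ((weak ht e).2 h2))
  -- The strict part of Pareto asks for strictness in the first event, so the roles of `A` and `B`
  -- are exchanged.
  · rw [Event.union_comm]
    exact (strict ht e).1 ((hPareto B A hAB.symm x y).2 ((strict ht e).2 h2) ((weak ht e).2 h1))

/-- Under richness, the normalized utilities given single states do not lie in a plane. -/
lemma exists_notMem_span_pair_of_richness (hRich : Richness R) {d : M → ℝ} {V : Event Ω → M → ℝ}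
    (hV : ∀ A x y, WeakPref R A x y ↔ (y : M → ℝ) ⬝ᵥ V A ≤ (x : M → ℝ) ⬝ᵥ V A)
    (hd : ∀ A, d ⬝ᵥ V A = 1) (x y : M → ℝ) :
    ∃ ω, V (Event.single ω) ∉ Submodule.span ℝ {x, y} := by
  obtain ⟨T, hT, h⟩ := hRich
  obtain ⟨i, j, k, hij, hik, hjk, rfl⟩ := Finset.card_eq_three.1 hT
  have sep : ∀ ω ∈ ({i, j, k} : Finset Ω), ∃ v : M → ℝ, 0 < v ⬝ᵥ V (Event.single ω) ∧
      ∀ ω' ∈ ({i, j, k} : Finset Ω), ω' ≠ ω → v ⬝ᵥ V (Event.single ω') ≤ 0 := by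
    intro ω hω
    obtain ⟨x, y, hs, hw⟩ := h ω hω
    refine ⟨(x : M → ℝ) - y, ?_, fun ω' h1 h2 => ?_⟩
    · rw [StrictPref, hV, hV, ← lt_iff_le_not_ge] at hs
      rw [sub_dotProduct]; linarith
    · have := (hV _ _ _).1 (hw ω' h1 h2)
      rw [sub_dotProduct]; linarith
  obtain ⟨v₁, p₁, n₁⟩ := sep i (by simp)
  obtain ⟨v₂, p₂, n₂⟩ := sep j (by simp)
  obtain ⟨v₃, p₃, n₃⟩ := sep k (by simp)
  have ind : IndepTriple (V (Event.single i)) (V (Event.single j)) (V (Event.single k)) :=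
    indepTriple_of_separated (hd _) (hd _) (hd _)
      ⟨p₁, n₁ j (by simp) hij.symm, n₁ k (by simp) hik.symm⟩
      ⟨p₂, n₂ i (by simp) hij, n₂ k (by simp) hjk.symm⟩
      ⟨p₃, n₃ i (by simp) hik, n₃ j (by simp) hjk⟩
  by_contra hcon
  push Not at hcon
  exact ind.not_subset_span_pair (hcon i) (hcon j) (hcon k)

/-- The linear functional evaluating a utility at a vector of weights. -/
def dotProductLinear (d : M → ℝ) : (M → ℝ) →ₗ[ℝ] ℝ where
  toFun U := d ⬝ᵥ U
  map_add' := dotProduct_add d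
  map_smul' c U := dotProduct_smul c d U

end Representation

end StateDep

/-! ### Existence and uniqueness of the representation. -/

theorem theorem8 {Ω M : Type*} [Fintype Ω] [DecidableEq Ω] [Fintype M]
    (R : StateDep.CondAct Ω M → StateDep.CondAct Ω M → Prop)
    (hOrder : StateDep.WeakOrder R)
    (hCont : StateDep.VNMContinuity R)
    (hInd : StateDep.Independence R)
    (hPareto : StateDep.ExtendedPareto R)
    (hRich : StateDep.Richness R)
    (xhi xlo : StateDep.Lottery M)
    (hAgree : StateDep.StrongMinimalAgreement R xhi xlo) :
    ∃ (P : Ω → ℝ) (u : Ω → M → ℝ),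
      (StateDep.Represents R P u ∧
        StateDep.RespectsIndiff R u xhi ∧ StateDep.RespectsIndiff R u xlo) ∧
      ∀ (Q : Ω → ℝ) (w : Ω → M → ℝ),
        (StateDep.Represents R Q w ∧
          StateDep.RespectsIndiff R w xhi ∧ StateDep.RespectsIndiff R w xlo) ↔
        (Q = P ∧ ∃ a b : ℝ, 0 < a ∧ ∀ ω m, w ω m = a * u ω m + b) := by
  open StateDep in
  obtain ⟨hstrict, hindhi, hindlo⟩ := hAgree
  have hex := fun A : Event Ω =>
    (isVNM_weakPref hOrder hCont hInd A).exists_utility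
      (strictPref_of_single hPareto hstrict A).1 (strictPref_of_single hPareto hstrict A).2
  choose V hV hhi hlo using hex
  have hT := exists_notMem_span_pair_of_richness hRich hV hhi
  -- The value at the empty set is a dummy; betweenness concerns nonempty sets only.
  set U : Finset Ω → M → ℝ := fun A => if h : A.Nonempty then V ⟨A, h⟩ else 0 with hUdef
  have hUV : ∀ A : Event Ω, U A.1 = V A := fun A => dif_pos A.2
  have hUs : ∀ ω, U {ω} = V (Event.single ω) := fun ω => hUV (Event.single ω)
  have hbetween : IsBetweenFamily (dotProductLinear (xhi : M → ℝ)) U := by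
    refine ⟨fun A hA => ?_, fun A B hA hB hAB => ?_⟩
    · rw [hUV ⟨A, hA⟩]
      exact hhi _
    · obtain ⟨a, b, ha, hb, e⟩ := exists_pos_combination_of_pareto hPareto hV hhi hlo
        (A := ⟨A, hA⟩) (B := ⟨B, hB⟩) hAB
      exact ⟨a, b, ha, hb, by
        rw [hUV ⟨A, hA⟩, hUV ⟨B, hB⟩, ← e]; exact hUV (Event.union ⟨A, hA⟩ ⟨B, hB⟩)⟩
  have hT' : ∀ x y : M → ℝ, ∃ d, U {d} ∉ Submodule.span ℝ {x, y} := fun x y => by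
    obtain ⟨d, hd⟩ := hT x y
    exact ⟨d, by rwa [hUs]⟩
  obtain ⟨p, hp, hpU⟩ := hbetween.exists_weights hT'
  obtain ⟨ω₀, -⟩ := hT 0 0
  have hs : 0 < ∑ ω, p ω := Finset.sum_pos (fun i _ => hp i) ⟨ω₀, Finset.mem_univ _⟩
  set P : Ω → ℝ := fun ω => (∑ ω, p ω)⁻¹ * p ω with hPdef
  have hP : IsPosProb P := by
    refine ⟨fun ω => mul_pos (inv_pos.2 hs) (hp ω), ?_⟩
    rw [hPdef, ← Finset.mul_sum, inv_mul_cancel₀ hs.ne']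
  have hPU : ∀ A : Finset Ω, A.Nonempty → (∑ i ∈ A, P i) • U A = ∑ i ∈ A, P i • U {i} := by
    intro A hA
    simp only [hPdef, ← Finset.mul_sum, mul_smul, ← Finset.smul_sum]
    rw [hpU A hA]
  set u : Ω → M → ℝ := fun ω => U {ω} with hu
  have hcond : ∀ A x, condExpUtil P u A x = (x : M → ℝ) ⬝ᵥ V A := by
    intro A x
    rw [condExpUtil_eq_dotProduct, ← hPU A.1 A.2, smul_smul, inv_mul_cancel₀ (hP.sum_pos A).ne',
      one_smul, hUV]
  have huhi : ∀ ω, expUtil u ω xhi = 1 := fun ω => by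
    rw [expUtil_eq_dotProduct, hu]; simp only [hUs, hhi]
  have hulo : ∀ ω, expUtil u ω xlo = 0 := fun ω => by
    rw [expUtil_eq_dotProduct, hu]; simp only [hUs, hlo]
  have hrep : ∀ A x y, WeakPref R A x y ↔ condExpUtil P u A x ≥ condExpUtil P u A y := by
    intro A x y
    rw [hV, hcond, hcond]
  refine ⟨P, u, ⟨⟨hP, hrep⟩, fun ω₁ ω₂ _ => by rw [huhi, huhi],
    fun ω₁ ω₂ _ => by rw [hulo, hulo]⟩, fun Q w => ⟨?_, ?_⟩⟩
  · rintro ⟨⟨hQ, hw⟩, hwhi, hwlo⟩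
    -- The values at `ω₀` serve for all states, because `w` respects the indifferences for `xhi` and
    -- `xlo`.
    set b := expUtil w ω₀ xlo with hb
    set a := expUtil w ω₀ xhi - b with ha
    have ha0 : 0 < a := by
      have h := (hstrict ω₀).2
      rw [hw, condExpUtil_single hQ, condExpUtil_single hQ] at h
      rw [ha, hb]
      linarith [not_le.1 h]
    set w' : Ω → M → ℝ := fun ω m => (w ω m - b) / a with hw'
    have hww' : ∀ ω m, w ω m = a * w' ω m + b := fun ω m => by
      rw [hw']; field_simp; ring
    have hi : ∀ ω, expUtil w' ω xhi = 1 := fun ω => by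
      have h1 := expUtil_affine hww' ω xhi
      rw [hwhi ω ω₀ (hindhi ω ω₀)] at h1
      exact mul_left_cancel₀ ha0.ne' (by linarith)
    have lo : ∀ ω, expUtil w' ω xlo = 0 := fun ω => by
      have h1 := expUtil_affine hww' ω xlo
      rw [hwlo ω ω₀ (hindlo ω ω₀)] at h1
      exact mul_left_cancel₀ ha0.ne' (by linarith)
    -- The conditional average of `w'` represents the preference given `A` with the same
    -- normalization as `V A`. On singletons this gives `w' = u`, and on general events the weight
    -- relation for `Q`.
    have hVw : ∀ A : Event Ω, V A = (∑ ω ∈ A.1, Q ω)⁻¹ • ∑ ω ∈ A.1, Q ω • w' ω := by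
      intro A
      refine utility_unique (h := xhi) (l := xlo) (hV A) (fun x y => ?_) (hhi A) ?_ (hlo A) ?_
      · rw [hw, condExpUtil_affine hQ hww', condExpUtil_affine hQ hww',
          ← condExpUtil_eq_dotProduct, ← condExpUtil_eq_dotProduct, ge_iff_le,
          add_le_add_iff_right, mul_le_mul_iff_right₀ ha0]
      · rw [← condExpUtil_eq_dotProduct, condExpUtil_const hQ hi]
      · rw [← condExpUtil_eq_dotProduct, condExpUtil_const hQ lo]
    have huw : ∀ ω, u ω = w' ω := fun ω => by
      rw [hu]
      simp only [hUs]
      rw [hVw]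
      simp only [Event.single, Finset.sum_singleton]
      rw [smul_smul, inv_mul_cancel₀ (hQ.1 ω).ne', one_smul]
    refine ⟨posProb_unique hT' hP hQ hPU fun A hA => ?_, a, b, ha0, fun ω m => ?_⟩
    · rw [hUV ⟨A, hA⟩, hVw, smul_smul, mul_inv_cancel₀ (hQ.sum_pos ⟨A, hA⟩).ne', one_smul]
      exact Finset.sum_congr rfl fun ω _ => by rw [← huw ω]
    · rw [huw, hww']
  · rintro ⟨rfl, a, b, ha, hw⟩
    refine ⟨⟨hP, fun A x y => ?_⟩, fun ω₁ ω₂ _ => ?_, fun ω₁ ω₂ _ => ?_⟩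
    · rw [hrep, condExpUtil_affine hP hw, condExpUtil_affine hP hw, ge_iff_le, ge_iff_le,
        add_le_add_iff_right, mul_le_mul_iff_right₀ ha]
    · rw [expUtil_affine hw, expUtil_affine hw, huhi, huhi]
    · rw [expUtil_affine hw, expUtil_affine hw, hulo, hulo]
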